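/- Let $(f_n)_{n\ge 0}$ be the regular paper-folding sequence, i.e. the $\{0,1\}$-valued sequence determined by $$f_{2n+1}=f_n,\qquad f_{4n}=0,\qquad f_{4n+2}=1\qquad(n\ge 0),$$ and let $S(n)=\sum_{i=0}^{n} f_i$ be its running sum. A function $F:\mathbb{N}\to\mathbb{N}$ is called $2$-synchronised if there is a finite automaton that reads pairs $(n,s)$ of natural numbers, with the base-$2$ digits of $n$ and $s$ read in parallel, most significant digit first and padded with leading zeros to a common length (any amount of leading zeros being allowed), and that accepts $(n,s)$ if and only if $F(n)=s$. Then: 1. $S$ is not $2$-synchronised. 2. For every integer $r\ge 1$ and $n=(4^{r+1}-1)/3$, one has $S(n)=\frac{n+1}{2}-r$. 3. The function $g:\mathbb{N}\to\mathbb{N}$ given by $g(n)=\max\left(\frac{n+1}{2}-S(n),\,0\right)$ if $n=(4^{r+1}-1)/3$ for some integer $r\ge 0$, and $g(n)=0$ for all other $n$, is unbounded and satisfies $g(n)=O(\log n)$ as $n\to\infty$. -/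

import Mathlib

open Filter Asymptotics

/-- The regular paper-folding sequence `0, 0, 1, 0, 0, 1, 1, 0, …`, indexed from `0`.
The three lemmas below are its defining relations. -/
def paperfold (n : ℕ) : ℕ :=
  if n % 2 = 1 then paperfold (n / 2) else if n % 4 = 0 then 0 else 1
termination_by n
decreasing_by omega

theorem paperfold_two_mul_add_one (n : ℕ) : paperfold (2 * n + 1) = paperfold n := by
  rw [paperfold, if_pos (by omega)]
  congr 1
  omega

theorem paperfold_four_mul (n : ℕ) : paperfold (4 * n) = 0 := by
  rw [paperfold, if_neg (by omega), if_pos (by omega)]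

theorem paperfold_four_mul_add_two (n : ℕ) : paperfold (4 * n + 2) = 1 := by
  rw [paperfold, if_neg (by omega), if_neg (by omega)]

/-- The running sum `a 0 + a 1 + ⋯ + a n`. -/
def runningSum (a : ℕ → ℕ) (n : ℕ) : ℕ := ∑ i ∈ Finset.range (n + 1), a i

/-- The number written in base `b` by a word of digits, most significant digit first.
Leading zeros are allowed; the empty word writes `0`. -/
def msdValue (b : ℕ) (w : List (Fin b)) : ℕ := 
  w.foldl (fun (v : ℕ) (d : Fin b) => b * v + d.val) 0

/-- `f` is `(k, l)`-synchronised: some finite automaton reads the base-`k` digits of `n` and the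
base-`l` digits of `s` in parallel, most significant digit first (the shorter expansion being padded
with leading zeros), and accepts the pair `(n, s)` exactly when `f n = s`. -/
def IsSynchronisedPair (k l : ℕ) (f : ℕ → ℕ) : Prop :=
  ∃ (σ : Type) (_ : Fintype σ) (M : DFA (Fin k × Fin l) σ),
    ∀ w : List (Fin k × Fin l),
      w ∈ M.accepts ↔ f (msdValue k (w.map Prod.fst)) = msdValue l (w.map Prod.snd)

/-- `f` is `k`-synchronised: both `n` and `f n` are written in base `k`. -/
def IsSynchronised (k : ℕ) (f : ℕ → ℕ) : Prop := IsSynchronisedPair k k f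

open Classical in
/-- The function equal to the truncated difference of `(n + 1) / 2` and the running sum of the
paper-folding sequence when `n = (4 ^ (r + 1) - 1) / 3` for some `r` (both divisions are exact for
such `n`), and to `0` for all other `n`. -/
noncomputable def paperfoldGap (n : ℕ) : ℕ :=
  if ∃ r : ℕ, 3 * n + 1 = 4 ^ (r + 1) then (n + 1) / 2 - runningSum paperfold n else 0

/-! For odd `m`, the recursion makes the deficit `(m + 1) / 2 - S m` grow by exactly `paperfold m`
under `m ↦ 4 * m + 1`. Along `1, 5, 21, …` this increment is `1` from `5` on, so the deficit is
linear in `r`, hence logarithmic in `n`. Such a deficit alters only the low digits of `S n`: the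
leading digits of `(n, S n)` are periodic, and a finite automaton cannot remember how many were
read, though the last digits depend on it. -/

theorem runningSum_succ (a : ℕ → ℕ) (n : ℕ) :
    runningSum a (n + 1) = runningSum a n + a (n + 1) :=
  Finset.sum_range_succ a (n + 1)

/-- The odd-indexed terms up to `2 n + 1` repeat the sequence up to `n`, and the even-indexed ones
alternate between `0` and `1`. -/
theorem runningSum_paperfold_two_mul_add_one (n : ℕ) :
    runningSum paperfold (2 * n + 1) = runningSum paperfold n + (n + 1) / 2 := by
  induction n with
  | zero =>
    have h0 := paperfold_four_mul 0
    have h1 := paperfold_two_mul_add_one 0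
    simp_all [runningSum, Finset.sum_range_succ]
  | succ n ih =>
    rw [show 2 * (n + 1) + 1 = 2 * n + 1 + 1 + 1 by ring, runningSum_succ, runningSum_succ, ih,
      runningSum_succ _ n, show 2 * n + 1 + 1 + 1 = 2 * (n + 1) + 1 by ring,
      paperfold_two_mul_add_one]
    rcases Nat.even_or_odd' n with ⟨m, rfl | rfl⟩
    · rw [show 2 * (2 * m) + 1 + 1 = 4 * m + 2 by ring, paperfold_four_mul_add_two]
      omega
    · rw [show 2 * (2 * m + 1) + 1 + 1 = 4 * (m + 1) by ring, paperfold_four_mul]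
      omega

/-- Apply the doubling rule to `2 * m` and to `m`; the former needs `S (2 * m)`, which is `S (2 * m
+ 1)` less its last term `paperfold m`. -/
theorem runningSum_paperfold_four_mul_add_one {m : ℕ} (hm : m % 2 = 1) :
    runningSum paperfold (4 * m + 1) + paperfold m =
      runningSum paperfold m + (m + 1) / 2 + m := by
  have h1 := runningSum_paperfold_two_mul_add_one (2 * m)
  have h2 := runningSum_succ paperfold (2 * m)
  rw [runningSum_paperfold_two_mul_add_one, paperfold_two_mul_add_one] at h2
  rw [show 4 * m + 1 = 2 * (2 * m) + 1 by ring, h1]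
  omega

theorem two_mul_runningSum_paperfold (r n : ℕ) (hn : 3 * n + 1 = 4 ^ (r + 2)) :
    2 * runningSum paperfold n + 2 * (r + 1) = n + 1 := by
  induction r generalizing n with
  | zero =>
    -- The induction starts at `5`: `paperfold 1 = 0`, so the step from `1` to `5` leaves the
    -- deficit at `1`.
    obtain rfl : n = 4 * 1 + 1 := by omega
    have h := runningSum_paperfold_four_mul_add_one (m := 1) rfl
    have h1 := runningSum_paperfold_two_mul_add_one 0
    have h2 := paperfold_two_mul_add_one 0
    have h3 : runningSum paperfold 0 = paperfold 0 := by simp [runningSum]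
    have h4 := paperfold_four_mul 0
    simp only [mul_zero, zero_add] at h1 h2 h4
    omega
  | succ r ih =>
    have hpow : 4 ^ (r + 1 + 2) = 64 * 4 ^ r := by ring
    have hpow' : 4 ^ (r + 2) = 16 * 4 ^ r := by ring
    obtain ⟨k, rfl⟩ : ∃ k, n = 4 * (4 * k + 1) + 1 := ⟨n / 16, by omega⟩
    have h := runningSum_paperfold_four_mul_add_one (m := 4 * k + 1) (by omega)
    have hS := ih (4 * k + 1) (by omega)
    have hf : paperfold (4 * k + 1) = 1 := by
      rw [show 4 * k + 1 = 2 * (2 * k) + 1 by ring, paperfold_two_mul_add_one,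
        -- Here `3 * k + 1 = 4 ^ (r + 1)`, so `k` is odd.
        show 2 * k = 4 * (k / 2) + 2 by omega, paperfold_four_mul_add_two]
    omega

theorem msdValue_concat (b : ℕ) (w : List (Fin b)) (d : Fin b) :
    msdValue b (w ++ [d]) = b * msdValue b w + d := by
  simp [msdValue]

theorem msdValue_append (b : ℕ) (u v : List (Fin b)) :
    msdValue b (u ++ v) = msdValue b u * b ^ v.length + msdValue b v := by
  induction v using List.reverseRecOn with
  | nil => simp [msdValue]
  | append_singleton v d ih =>
    rw [← List.append_assoc, msdValue_concat, ih, msdValue_concat, List.length_append,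
      List.length_singleton]
    ring

/-- Any two numbers that are small enough are written by a common word of pairs of digits. -/
theorem exists_word_msdValue (k l L n s : ℕ) (hn : n < k ^ L) (hs : s < l ^ L) :
    ∃ w : List (Fin k × Fin l), w.length = L ∧
      msdValue k (w.map Prod.fst) = n ∧ msdValue l (w.map Prod.snd) = s := by
  induction L generalizing n s with
  | zero => exact ⟨[], rfl, by simp_all [msdValue], by simp_all [msdValue]⟩
  | succ L ih =>
    have hk : 0 < k := Nat.pos_of_ne_zero (by rintro rfl; simp at hn)
    have hl : 0 < l := Nat.pos_of_ne_zero (by rintro rfl; simp at hs)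
    obtain ⟨w, hw, h1, h2⟩ := ih (n / k) (s / l)
      (Nat.div_lt_of_lt_mul (by rwa [← pow_succ']))
      (Nat.div_lt_of_lt_mul (by rwa [← pow_succ']))
    refine ⟨w ++ [(⟨n % k, Nat.mod_lt _ hk⟩, ⟨s % l, Nat.mod_lt _ hl⟩)], by simp [hw], ?_, ?_⟩
    · rw [List.map_append, List.map_singleton, msdValue_concat, h1]
      exact Nat.div_add_mod n k
    · rw [List.map_append, List.map_singleton, msdValue_concat, h2]
      exact Nat.div_add_mod s l

theorem exists_three_mul_add_one_eq_four_pow (k : ℕ) : ∃ a, 3 * a + 1 = 4 ^ k := by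
  induction k with
  | zero => exact ⟨0, rfl⟩
  | succ k ih =>
    obtain ⟨a, ha⟩ := ih
    exact ⟨4 * a + 1, by rw [pow_succ, ← ha]; ring⟩

/-- Among the words whose digits are the leading ones of `(n, S n)` with `3 n + 1 = 4 ^ (r + 1)`,
two of different lengths lead to the same state, although `S n` has different final digits after
them. -/
theorem not_isSynchronised_runningSum_paperfold :
    ¬ IsSynchronised 2 (runningSum paperfold) := by
  rintro ⟨σ, _, M, hM⟩
  have hprefix (i : ℕ) : ∃ w : List (Fin 2 × Fin 2),
      3 * msdValue 2 (w.map Prod.fst) + 1 = 4 ^ (i + 1) ∧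
      3 * msdValue 2 (w.map Prod.snd) + 2 = 2 * 4 ^ i := by
    obtain ⟨a, ha⟩ := exists_three_mul_add_one_eq_four_pow (i + 1)
    obtain ⟨t, ht⟩ := exists_three_mul_add_one_eq_four_pow i
    have hpow : 4 ^ (i + 1) = 4 * 4 ^ i := by ring
    have hpow' : 2 ^ (2 * (i + 1)) = 4 * 4 ^ i := by rw [pow_mul, ← hpow]; norm_num
    obtain ⟨w, -, h1, h2⟩ := exists_word_msdValue 2 2 (2 * (i + 1)) a (2 * t)
      (by omega) (by omega)
    exact ⟨w, by omega, by omega⟩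
  choose p hpn hps using hprefix
  obtain ⟨i, i', hne, heq⟩ := Finite.exists_ne_map_eq_of_infinite fun i => M.eval (p i)
  -- A tail of `2 * j` digits is long enough to absorb the deficit `i + j` without a borrow from the
  -- prefix.
  obtain ⟨j, hj⟩ : ∃ j : ℕ, j = i + i' + 2 := ⟨_, rfl⟩
  obtain ⟨b, hb⟩ := exists_three_mul_add_one_eq_four_pow j
  have hlt : j < 2 ^ j := Nat.lt_two_pow_self
  have hsq : (4 : ℕ) ^ j = 2 ^ j * 2 ^ j := by rw [← mul_pow]; norm_num
  have hlarge : 3 * j ≤ 4 ^ j := by nlinarith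
  -- The tail of `S n` that is correct after `p i`; after `p m` it is off by `m - i`.
  obtain ⟨u, hu⟩ : ∃ u, u + (i + j) = 2 * b + 1 := ⟨2 * b + 1 - (i + j), by omega⟩
  have hpow : (2 : ℕ) ^ (2 * j) = 4 ^ j := by rw [pow_mul]; norm_num
  obtain ⟨v, hv, hvn, hvs⟩ := exists_word_msdValue 2 2 (2 * j) b u (by omega) (by omega)
  have hfst (m : ℕ) : msdValue 2 ((p m ++ v).map Prod.fst) =
      msdValue 2 ((p m).map Prod.fst) * 4 ^ j + b := by
    rw [List.map_append, msdValue_append, List.length_map, hv, hpow, hvn]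
  have hsnd (m : ℕ) : msdValue 2 ((p m ++ v).map Prod.snd) =
      msdValue 2 ((p m).map Prod.snd) * 4 ^ j + u := by
    rw [List.map_append, msdValue_append, List.length_map, hv, hpow, hvs]
  have hvalue (m : ℕ) : 2 * runningSum paperfold (msdValue 2 ((p m ++ v).map Prod.fst)) +
      2 * (m + j) = 2 * (msdValue 2 ((p m ++ v).map Prod.snd)) + 2 * (i + j) := by
    have hn : 3 * msdValue 2 ((p m ++ v).map Prod.fst) + 1 = 4 ^ (m + j + 1) := by
      rw [hfst, show m + j + 1 = m + 1 + j by ring, pow_add, ← hpn m, ← hb]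
      ring
    have hs : 3 * (msdValue 2 ((p m ++ v).map Prod.snd) + (i + j)) = 2 * 4 ^ (m + j) + 1 := by
      rw [hsnd, add_assoc, hu, pow_add, ← mul_assoc, ← hps m, ← hb]
      ring
    obtain ⟨r, hr⟩ : ∃ r, m + j = r + 1 := ⟨m + j - 1, by omega⟩
    have h := two_mul_runningSum_paperfold r (msdValue 2 ((p m ++ v).map Prod.fst))
      (by rw [hn, hr])
    have hpow'' : 4 ^ (m + j + 1) = 4 * 4 ^ (m + j) := by ring
    omega
  have haccept : p i ++ v ∈ M.accepts := by
    rw [hM]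
    have := hvalue i
    omega
  have haccept' : p i' ++ v ∈ M.accepts := by
    rw [DFA.mem_accepts, DFA.eval, DFA.evalFrom_of_append] at haccept ⊢
    simp only [DFA.eval] at heq
    rwa [← heq]
  rw [hM] at haccept'
  have := hvalue i'
  omega

theorem paperfoldGap_eq (r n : ℕ) (hn : 3 * n + 1 = 4 ^ (r + 2)) : paperfoldGap n = r + 1 := by
  have h := two_mul_runningSum_paperfold r n hn
  rw [paperfoldGap, if_pos ⟨r + 1, hn⟩]
  omega

theorem paperfoldGap_le_log {n : ℕ} (hn : 2 ≤ n) : (paperfoldGap n : ℝ) ≤ Real.log n := by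
  by_cases h : ∃ r : ℕ, 3 * n + 1 = 4 ^ (r + 1)
  · obtain ⟨_ | r, hr⟩ := h
    · omega
    · rw [paperfoldGap_eq r n hr]
      have hle : 4 ^ (r + 1) ≤ n := by
        have : 4 ^ (r + 1 + 1) = 4 * 4 ^ (r + 1) := by ring
        omega
      rw [Real.le_log_iff_exp_le (by positivity), ← mul_one ((r + 1 : ℕ) : ℝ), Real.exp_nat_mul]
      -- The constant `1` suffices because `e < 4`.
      calc Real.exp 1 ^ (r + 1) ≤ 4 ^ (r + 1) := by
            gcongr
            linarith [Real.exp_one_lt_d9]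
        _ ≤ n := by exact_mod_cast hle
  · rw [paperfoldGap, if_neg h, Nat.cast_zero]
    exact Real.log_natCast_nonneg n

theorem mainTheorem3 :
    ¬ IsSynchronised 2 (runningSum paperfold) ∧
    (∀ r n : ℕ, 1 ≤ r → 3 * n + 1 = 4 ^ (r + 1) →
      (runningSum paperfold n : ℚ) = ((n : ℚ) + 1) / 2 - (r : ℚ)) ∧
    (∀ C : ℕ, ∃ n : ℕ, C < paperfoldGap n) ∧
    (fun n : ℕ => (paperfoldGap n : ℝ)) =O[atTop] (fun n : ℕ => Real.log (n : ℝ)) := by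
  refine ⟨not_isSynchronised_runningSum_paperfold, fun r n hr hn => ?_, fun C => ?_, ?_⟩
  · obtain ⟨r, rfl⟩ := Nat.exists_eq_add_of_le' hr
    have h : (2 * runningSum paperfold n + 2 * (r + 1) : ℚ) = n + 1 := by
      exact_mod_cast two_mul_runningSum_paperfold r n hn
    push_cast
    linarith
  · obtain ⟨n, hn⟩ := exists_three_mul_add_one_eq_four_pow (C + 2)
    exact ⟨n, by rw [paperfoldGap_eq C n hn]; omega⟩
  · refine IsBigO.of_bound 1 ?_
    filter_upwards [eventually_ge_atTop 2] with n hn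
    rw [one_mul, Real.norm_of_nonneg (Nat.cast_nonneg _),
      Real.norm_of_nonneg (Real.log_natCast_nonneg n)]
    exact paperfoldGap_le_log hn
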